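/- Let $P_1,P_2,P_3,P_4$ be the vertices of a (nondegenerate) square in the Euclidean plane $\mathbb R^2$, labelled so that $P_1$ is opposite to $P_3$ and $P_2$ is opposite to $P_4$, and let $P_5$ be the center of the square. For $i=1,\dots,5$ let $\psi_i(x)=P_i+\tfrac13(x-P_i)$, and let $K\subset\mathbb R^2$ be the Vicsek set, that is, the unique nonempty compact set with $K=\bigcup_{i=1}^5\psi_i(K)$. Let $\alpha=(\alpha_1,\dots,\alpha_5)$ be a polyratio, that is, $0<\alpha_i<1$ for every $i$. The polyratio $\alpha$ is called metric on $K$ if there is a distance (metric) $d$ on the set $K$ such that every $\psi_i$ is $\alpha_i$-Lipschitz for $d$, that is, $d(\psi_i(x),\psi_i(y))\le\alpha_i\,d(x,y)$ for all $x,y\in K$ and $i=1,\dots,5$. Then $\alpha$ is metric on $K$ if and only if $$\alpha_1+\alpha_3+\alpha_5\ge 1\quad\text{and}\quad \alpha_2+\alpha_4+\alpha_5\ge 1.$$ -/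

import Mathlib

/-- `K` is the self-similar set generated by the maps `ψ i`: it is a nonempty compact set with
`K = ⋃ i, ψ i (K)`. -/
structure IsSelfSimilarSet {X ι : Type*} [TopologicalSpace X] (ψ : ι → X → X) (K : Set X) :
    Prop where
  nonempty : K.Nonempty
  isCompact : IsCompact K
  eq_iUnion : K = ⋃ i, ψ i '' K

/-- `α` is a polyratio: every `α i` lies in the open interval `(0, 1)`. -/
def IsPolyratio {ι : Type*} (α : ι → ℝ) : Prop :=
  ∀ i, α i ∈ Set.Ioo (0 : ℝ) 1

/-- `α` is metric for the maps `ψ i : X → X`: there is a distance on `X` for which every `ψ i` is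
`α i`-Lipschitz. The distance is not required to be related to a given topology on `X`. -/
def IsMetricPolyratio {X ι : Type*} (ψ : ι → X → X) (α : ι → ℝ) : Prop :=
  ∃ _ : MetricSpace X, ∀ (i : ι) (x y : X), dist (ψ i x) (ψ i y) ≤ α i * dist x y

/-- `P 0, P 1, P 2, P 3` are the vertices of a nondegenerate square in the Euclidean plane with
center `P 4`, labelled so that `P 0` is opposite to `P 2` and `P 1` is opposite to `P 3`: the two
diagonals have the same midpoint `P 4`, are perpendicular, and have the same positive length. -/
structure IsCenteredSquare (P : Fin 5 → EuclideanSpace ℝ (Fin 2)) : Prop where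
  midpoint_zero_two : midpoint ℝ (P 0) (P 2) = P 4
  midpoint_one_three : midpoint ℝ (P 1) (P 3) = P 4
  inner_eq_zero : inner ℝ (P 2 - P 0) (P 3 - P 1) = 0
  dist_eq : dist (P 0) (P 2) = dist (P 1) (P 3)
  ne : P 0 ≠ P 2

/-- The contraction of ratio `1 / 3` centered at `P i`, that is `x ↦ P i + (x - P i) / 3`. -/
noncomputable def vicsekContraction (P : Fin 5 → EuclideanSpace ℝ (Fin 2)) (i : Fin 5) :
    EuclideanSpace ℝ (Fin 2) → EuclideanSpace ℝ (Fin 2) :=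
  AffineMap.homothety (P i) (1 / 3 : ℝ)

theorem vicsekContraction_apply (P : Fin 5 → EuclideanSpace ℝ (Fin 2)) (i : Fin 5)
    (x : EuclideanSpace ℝ (Fin 2)) :
    vicsekContraction P i x = (1 / 3 : ℝ) • x + (2 / 3 : ℝ) • P i := by
  simp only [vicsekContraction, AffineMap.homothety_apply, vsub_eq_sub, vadd_eq_add]
  module

theorem exists_isSelfSimilarSet_vicsekContraction (P : Fin 5 → EuclideanSpace ℝ (Fin 2)) :
    ∃ K, IsSelfSimilarSet (vicsekContraction P) K := by
  have hs : Summable fun n : ℕ => (1 / 3 : ℝ) ^ n * ((2 / 3) * ∑ i, ‖P i‖) :=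
    (summable_geometric_of_lt_one (by norm_num) (by norm_num)).mul_right _
  let f : ℕ → (ℕ → Fin 5) → EuclideanSpace ℝ (Fin 2) :=
    fun n w => (1 / 3 : ℝ) ^ n • ((2 / 3 : ℝ) • P (w n))
  have hb : ∀ n w, ‖f n w‖ ≤ (1 / 3 : ℝ) ^ n * ((2 / 3) * ∑ i, ‖P i‖) := by
    intro n w
    have h1 : ‖P (w n)‖ ≤ ∑ i, ‖P i‖ :=
      Finset.single_le_sum (f := fun i => ‖P i‖) (fun i _ => norm_nonneg _) (Finset.mem_univ (w n))
    have h2 : ‖f n w‖ = (1 / 3 : ℝ) ^ n * ((2 / 3) * ‖P (w n)‖) := by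
      simp [f, norm_smul]
    rw [h2]
    gcongr
  have hc : Continuous fun w => ∑' n, f n w := by
    refine continuous_tsum (fun n => ?_) hs hb
    have : Continuous fun i : Fin 5 => (1 / 3 : ℝ) ^ n • ((2 / 3 : ℝ) • P i) :=
      continuous_of_discreteTopology
    exact this.comp (continuous_apply n)
  have hstep : ∀ w : ℕ → Fin 5, ∑' n, f n w =
      vicsekContraction P (w 0) (∑' n, f n (fun m => w (m + 1))) := by
    intro w
    have hsum : Summable fun n => f n w := Summable.of_norm_bounded hs (fun n => hb n w)
    rw [hsum.tsum_eq_zero_add, vicsekContraction_apply, ← tsum_const_smul'', add_comm]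
    congr 1
    · refine tsum_congr fun n => ?_
      simp only [f, smul_smul]
      congr 1
      ring
    · simp [f]
  refine ⟨Set.range fun w => ∑' n, f n w, Set.range_nonempty _, isCompact_range hc, ?_⟩
  ext x
  simp only [Set.mem_iUnion, Set.mem_image, Set.mem_range, exists_exists_eq_and]
  constructor
  · rintro ⟨w, rfl⟩
    exact ⟨w 0, _, (hstep w).symm⟩
  · rintro ⟨i, w, rfl⟩
    refine ⟨fun n => Nat.casesOn n i w, ?_⟩
    exact hstep _

theorem isSelfSimilarSet_vicsekContraction_unique (P : Fin 5 → EuclideanSpace ℝ (Fin 2))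
    {K L : Set (EuclideanSpace ℝ (Fin 2))} (hK : IsSelfSimilarSet (vicsekContraction P) K)
    (hL : IsSelfSimilarSet (vicsekContraction P) L) : K = L := by
  have key : ∀ {A B : Set (EuclideanSpace ℝ (Fin 2))},
      IsSelfSimilarSet (vicsekContraction P) A → IsSelfSimilarSet (vicsekContraction P) B →
      A ⊆ B := by
    intro A B hA hB
    obtain ⟨x, hx, hmax⟩ := hA.isCompact.exists_isMaxOn hA.nonempty
      (Metric.continuous_infDist_pt B).continuousOn
    have hx' := hx
    rw [hA.eq_iUnion] at hx'
    obtain ⟨i, y, hy, rfl⟩ : ∃ i, ∃ y ∈ A, vicsekContraction P i y = x := by simpa using hx'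
    obtain ⟨b, hb, hyb⟩ := hB.isCompact.exists_infDist_eq_dist hB.nonempty y
    have hb' : vicsekContraction P i b ∈ B := by
      rw [hB.eq_iUnion]
      exact Set.mem_iUnion.2 ⟨i, b, hb, rfl⟩
    have h1 : Metric.infDist (vicsekContraction P i y) B ≤ 1 / 3 * Metric.infDist y B := by
      refine (Metric.infDist_le_dist_of_mem hb').trans (le_of_eq ?_)
      rw [hyb, vicsekContraction_apply, vicsekContraction_apply, dist_add_right, dist_smul₀]
      norm_num
    have h2 : Metric.infDist y B ≤ Metric.infDist (vicsekContraction P i y) B := hmax hy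
    intro z hz
    have h3 : Metric.infDist z B ≤ Metric.infDist (vicsekContraction P i y) B := hmax hz
    have h4 : 0 ≤ Metric.infDist z B := Metric.infDist_nonneg
    rw [hB.isCompact.isClosed.mem_iff_infDist_zero hB.nonempty]
    linarith
  exact (key hK hL).antisymm (key hL hK)

/-- The Vicsek set with corners `P 0, P 1, P 2, P 3` and center `P 4`: the only nonempty compact
set `K` with `K = ⋃ i, vicsekContraction P i '' K`. -/
noncomputable def vicsekSet (P : Fin 5 → EuclideanSpace ℝ (Fin 2)) :
    Set (EuclideanSpace ℝ (Fin 2)) :=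
  (exists_isSelfSimilarSet_vicsekContraction P).choose

theorem isSelfSimilarSet_vicsekSet (P : Fin 5 → EuclideanSpace ℝ (Fin 2)) :
    IsSelfSimilarSet (vicsekContraction P) (vicsekSet P) :=
  (exists_isSelfSimilarSet_vicsekContraction P).choose_spec

theorem mapsTo_vicsekSet (P : Fin 5 → EuclideanSpace ℝ (Fin 2)) (i : Fin 5) :
    Set.MapsTo (vicsekContraction P i) (vicsekSet P) (vicsekSet P) := by
  intro x hx
  rw [(isSelfSimilarSet_vicsekSet P).eq_iUnion]
  exact Set.mem_iUnion.2 ⟨i, x, hx, rfl⟩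

/-- The map `ψ i : K → K` of the Vicsek set `K`, the restriction of the contraction centered at
`P i`. -/
noncomputable def vicsekMap (P : Fin 5 → EuclideanSpace ℝ (Fin 2)) (i : Fin 5) :
    vicsekSet P → vicsekSet P :=
  (mapsTo_vicsekSet P i).restrict

/-! Necessity: the diagonal from one corner to the opposite one crosses a chain of three cells,
corner, center, corner, consecutive ones sharing a point. The triangle inequality bounds the
distance of the two corners by itself times the sum of the three ratios
(`one_le_sum_of_isMetricPolyratio`).

Sufficiency: the supremum of `|u x - u y|` over admissible `u` is a pseudodistance with the required
Lipschitz bounds, so it suffices that admissible functions separate points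
(`isMetricPolyratio_of_separating`). The sum conditions give a self-similar coordinate along each
diagonal, which separates a corner from every other point (`exists_admissible_ne_vertex`).
Transplanted into cells, these functions show that two unseparated points share a cell, with
unseparated preimages there; iterating, they share cells of every level and coincide
(`exists_admissible_ne`). -/

/-- Functions whose oscillation on every cell `ψ_w(X)` is at most the product of the ratios along
the word `w`. -/
def admissibleFunctions {X ι : Type*} (ψ : ι → X → X) (α : ι → ℝ) : Set (X → ℝ) :=
  {u | ∀ (w : List ι) (x y : X),
    |u (w.foldr ψ x) - u (w.foldr ψ y)| ≤ (w.map α).prod}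

/-! ### The pseudodistance defined by admissible functions -/

section Admissible

variable {X ι : Type*} {ψ : ι → X → X} {α : ι → ℝ}

theorem prod_map_nonneg (hα : ∀ i, 0 ≤ α i) (w : List ι) : 0 ≤ (w.map α).prod := by
  refine List.prod_nonneg fun a ha => ?_
  obtain ⟨i, -, rfl⟩ := List.mem_map.1 ha
  exact hα i

theorem zero_mem_admissibleFunctions (hα : ∀ i, 0 ≤ α i) :
    (fun _ => 0) ∈ admissibleFunctions ψ α := by
  intro w x y
  simpa using prod_map_nonneg hα w

theorem abs_sub_le_one_of_mem_admissibleFunctions {u : X → ℝ}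
    (hu : u ∈ admissibleFunctions ψ α) (x y : X) : |u x - u y| ≤ 1 := by
  simpa using hu [] x y

theorem comp_div_mem_admissibleFunctions {u : X → ℝ} (hu : u ∈ admissibleFunctions ψ α)
    {i : ι} (hi : 0 < α i) : (fun x => u (ψ i x) / α i) ∈ admissibleFunctions ψ α := by
  intro w x y
  have h := hu (i :: w) x y
  simp only [List.foldr_cons, List.map_cons, List.prod_cons] at h
  rw [← sub_div, abs_div, abs_of_pos hi, div_le_iff₀ hi, mul_comm]
  exact h

theorem mem_admissibleFunctions_of_comp {u : X → ℝ} (h1 : ∀ x y, |u x - u y| ≤ 1)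
    (h2 : ∀ i, ∃ v ∈ admissibleFunctions ψ α, ∃ c k : ℝ, |k| ≤ α i ∧
      ∀ x, u (ψ i x) = c + k * v x) : u ∈ admissibleFunctions ψ α := by
  rintro (_ | ⟨i, w⟩) x y
  · simpa using h1 x y
  · obtain ⟨v, hv, c, k, hk, h⟩ := h2 i
    simp only [List.foldr_cons, List.map_cons, List.prod_cons, h]
    rw [add_sub_add_left_eq_sub, ← mul_sub, abs_mul]
    exact mul_le_mul hk (hv w x y) (abs_nonneg _) ((abs_nonneg k).trans hk)

theorem mem_admissibleFunctions_of_selfSimilar {u : X → ℝ} {c k : ι → ℝ}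
    (h1 : ∀ x y, |u x - u y| ≤ 1) (hk : ∀ i, |k i| ≤ α i)
    (h : ∀ i x, u (ψ i x) = c i + k i * u x) : u ∈ admissibleFunctions ψ α := by
  intro w x y
  induction w with
  | nil => simpa using h1 x y
  | cons i w ih =>
    simp only [List.foldr_cons, List.map_cons, List.prod_cons, h]
    rw [add_sub_add_left_eq_sub, ← mul_sub, abs_mul]
    exact mul_le_mul (hk i) ih (abs_nonneg _) ((abs_nonneg _).trans (hk i))

/-- The Lipschitz bound holds because `u ∘ ψ i / α i` is again admissible; the empty word bounds the
supremum by 1. -/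
theorem isMetricPolyratio_of_separating (hα : ∀ i, 0 < α i)
    (h : ∀ x y : X, x ≠ y → ∃ u ∈ admissibleFunctions ψ α, u x ≠ u y) :
    IsMetricPolyratio ψ α := by
  let F := admissibleFunctions ψ α
  have hne : Nonempty F := ⟨⟨_, zero_mem_admissibleFunctions fun i => (hα i).le⟩⟩
  let D : X → X → ℝ := fun x y => ⨆ u : F, |u.1 x - u.1 y|
  have hle : ∀ (u : F) x y, |u.1 x - u.1 y| ≤ D x y := fun u x y =>
    le_ciSup (f := fun u : F => |u.1 x - u.1 y|)
      ⟨1, by rintro _ ⟨v, rfl⟩; exact abs_sub_le_one_of_mem_admissibleFunctions v.2 x y⟩ u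
  let m : MetricSpace X :=
    { dist := D
      dist_self := fun x => by simp [D]
      dist_comm := fun x y => by simp only [D, abs_sub_comm]
      dist_triangle := fun x y z => ciSup_le fun u =>
        (abs_sub_le _ (u.1 y) _).trans (add_le_add (hle u x y) (hle u y z))
      eq_of_dist_eq_zero := fun {x y} hxy => by
        by_contra hne
        obtain ⟨u, hu, huxy⟩ := h x y hne
        have h0 : |u x - u y| ≤ D x y := hle ⟨u, hu⟩ x y
        have h1 : D x y = 0 := hxy
        rw [h1] at h0
        exact huxy (sub_eq_zero.1 (abs_nonpos_iff.1 h0)) }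
  refine ⟨m, fun i x y => ?_⟩
  change D (ψ i x) (ψ i y) ≤ α i * D x y
  refine ciSup_le fun u => ?_
  have h1 := hle ⟨_, comp_div_mem_admissibleFunctions u.2 (hα i)⟩ x y
  simp only [← sub_div, abs_div, abs_of_pos (hα i)] at h1
  rwa [div_le_iff₀ (hα i), mul_comm] at h1

end Admissible

/-- Knaster–Tarski in the complete lattice `X → unitInterval`; neither continuity nor contraction is
needed. -/
theorem exists_fixedPoint_unitInterval {X : Type*} (c k : X → ℝ) (g : X → X)
    (hc : ∀ x, 0 ≤ c x) (hk : ∀ x, 0 ≤ k x) (hck : ∀ x, c x + k x ≤ 1) :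
    ∃ u : X → ℝ, (∀ x, u x ∈ Set.Icc (0 : ℝ) 1) ∧ ∀ x, u x = c x + k x * u (g x) := by
  let T : (X → unitInterval) →o (X → unitInterval) :=
    { toFun := fun v x => ⟨c x + k x * v (g x),
        add_nonneg (hc x) (mul_nonneg (hk x) (v (g x)).2.1),
        (add_le_add_right (mul_le_of_le_one_right (hk x) (v (g x)).2.2) _).trans (hck x)⟩
      monotone' := fun v v' hv x => by
        have : (v (g x) : ℝ) ≤ v' (g x) := hv (g x)
        exact Subtype.mk_le_mk.2 (add_le_add_right (mul_le_mul_of_nonneg_left this (hk x)) _) }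
  refine ⟨fun x => OrderHom.lfp T x, fun x => (OrderHom.lfp T x).2, fun x => ?_⟩
  conv_lhs => rw [← OrderHom.map_lfp T]
  rfl

/-! ### Functions on a system with Vicsek combinatorics -/

/-- The index of the corner opposite to a given corner; the center `4` is its own opposite. -/
def oppositeVertex : Fin 5 → Fin 5 := ![2, 3, 0, 1, 4]

theorem oppositeVertex_oppositeVertex (i : Fin 5) :
    oppositeVertex (oppositeVertex i) = i := by
  revert i; decide

theorem oppositeVertex_ne_four {i : Fin 5} (hi : i ≠ 4) : oppositeVertex i ≠ 4 := by
  revert i; decide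

theorem oppositeVertex_ne_self {i : Fin 5} (hi : i ≠ 4) : oppositeVertex i ≠ i := by
  revert i; decide

/-- Maps `ψ i` on a set with the combinatorics of the Vicsek set: the cells `ψ i (X)`, `i ≠ 4`, are
pairwise disjoint, and each of them meets the central cell in one point. -/
structure IsVicsekSystem {X : Type*} (ψ : Fin 5 → X → X) (p : Fin 5 → X) : Prop where
  exists_eq : ∀ x, ∃ i y, ψ i y = x
  injective : ∀ i, Function.Injective (ψ i)
  apply_eq_apply : ∀ {i j x y}, i ≠ j → ψ i x = ψ j y →
    (j = 4 ∧ x = p (oppositeVertex i) ∧ y = p i) ∨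
      (i = 4 ∧ y = p (oppositeVertex j) ∧ x = p j)
  apply_opposite : ∀ i, ψ i (p (oppositeVertex i)) = ψ 4 (p i)
  apply_self : ∀ i, ψ i (p i) = p i
  vertex_injective : Function.Injective p
  eq_of_common_cells : ∀ x y, (∀ n : ℕ, ∃ w : List (Fin 5), w.length = n ∧
    ∃ x' y', x = w.foldr ψ x' ∧ y = w.foldr ψ y') → x = y

namespace IsVicsekSystem

variable {X : Type*} {ψ : Fin 5 → X → X} {p : Fin 5 → X} {α : Fin 5 → ℝ}

theorem exists_glue (h : IsVicsekSystem ψ p) (g : Fin 5 → X → ℝ)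
    (hg : ∀ i, i ≠ 4 → g i (p (oppositeVertex i)) = g 4 (p i)) :
    ∃ v : X → ℝ, ∀ i x, v (ψ i x) = g i x := by
  choose I Y hIY using h.exists_eq
  refine ⟨fun x => g (I x) (Y x), fun i x => ?_⟩
  have h0 := hIY (ψ i x)
  dsimp only
  generalize I (ψ i x) = j at h0 ⊢
  generalize Y (ψ i x) = y at h0 ⊢
  by_cases hij : j = i
  · subst hij
    rw [h.injective _ h0]
  · rcases h.apply_eq_apply hij h0 with ⟨rfl, rfl, rfl⟩ | ⟨rfl, rfl, rfl⟩
    · exact hg _ hij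
    · exact (hg _ (Ne.symm hij)).symm

theorem eq_of_apply_eq_vertex (h : IsVicsekSystem ψ p) {i j : Fin 5} (hi : i ≠ 4) {x : X}
    (hx : ψ j x = p i) : j = i ∧ x = p i := by
  rw [← h.apply_self i] at hx
  by_cases hij : j = i
  · subst hij
    exact ⟨rfl, h.injective _ hx⟩
  · rcases h.apply_eq_apply hij hx with ⟨h4, -, -⟩ | ⟨-, h1, -⟩
    · exact absurd h4 hi
    · exact absurd (h.vertex_injective h1).symm (oppositeVertex_ne_self hi)

/-- Solve the equation for one chosen address of each point. Only junctions have a second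
first-level address, and `hac` makes both give the same value, since `ha` and `hk1` force `u (p i) =
a i`. -/
theorem exists_selfSimilar (h : IsVicsekSystem ψ p) (c k : Fin 5 → ℝ)
    (hc : ∀ i, 0 ≤ c i) (hk : ∀ i, 0 ≤ k i) (hck : ∀ i, c i + k i ≤ 1) (a : Fin 5 → ℝ)
    (ha : ∀ i, i ≠ 4 → a i = c i + k i * a i) (hk1 : ∀ i, k i < 1)
    (hac : ∀ i, i ≠ 4 → c i + k i * a (oppositeVertex i) = c 4 + k 4 * a i) :
    ∃ u : X → ℝ, (∀ x, u x ∈ Set.Icc (0 : ℝ) 1) ∧ (∀ i, i ≠ 4 → u (p i) = a i) ∧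
      ∀ i x, u (ψ i x) = c i + k i * u x := by
  choose I Y hIY using h.exists_eq
  obtain ⟨u, hu1, hu⟩ := exists_fixedPoint_unitInterval (fun x => c (I x)) (fun x => k (I x)) Y
    (fun x => hc _) (fun x => hk _) (fun x => hck _)
  have hua : ∀ i, i ≠ 4 → u (p i) = a i := by
    intro i hi
    have h1 := hu (p i)
    obtain ⟨h2, h3⟩ := h.eq_of_apply_eq_vertex hi (hIY (p i))
    rw [h2, h3] at h1
    have h4 : (1 - k i) * (u (p i) - a i) = 0 := by linear_combination h1 - ha i hi
    rcases mul_eq_zero.1 h4 with h5 | h5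
    · linarith [hk1 i]
    · linarith
  refine ⟨u, hu1, hua, fun i x => ?_⟩
  have h0 := hIY (ψ i x)
  rw [hu (ψ i x)]
  generalize I (ψ i x) = j at h0 ⊢
  generalize Y (ψ i x) = y at h0 ⊢
  by_cases hij : j = i
  · subst hij
    rw [h.injective _ h0]
  · rcases h.apply_eq_apply hij h0 with ⟨rfl, rfl, rfl⟩ | ⟨rfl, rfl, rfl⟩
    · rw [hua _ hij, hua _ (oppositeVertex_ne_four hij)]
      exact hac _ hij
    · rw [hua _ (Ne.symm hij), hua _ (oppositeVertex_ne_four (Ne.symm hij))]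
      exact (hac _ (Ne.symm hij)).symm

/-! ### Separation of points, and necessity -/

theorem eq_vertex_of_mem_cells (h : IsVicsekSystem ψ p) {i : Fin 5} {S : Set X}
    (hS : ∀ x ∈ S, ∃ y ∈ S, ψ i y = x) {x : X} (hx : x ∈ S) : x = p i := by
  have h1 : ∀ n, ∃ x' ∈ S, x = (List.replicate n i).foldr ψ x' := by
    intro n
    induction n with
    | zero => exact ⟨x, hx, rfl⟩
    | succ n ih =>
      obtain ⟨x', hx', rfl⟩ := ih
      obtain ⟨y, hy, rfl⟩ := hS x' hx'
      exact ⟨y, hy, by simp [List.replicate_succ']⟩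
  have h2 : ∀ n, p i = (List.replicate n i).foldr ψ (p i) := by
    intro n
    induction n with
    | zero => rfl
    | succ n ih =>
      simpa only [List.replicate_succ', List.foldr_append, List.foldr_cons, List.foldr_nil,
        h.apply_self] using ih
  refine h.eq_of_common_cells _ _ fun n => ⟨List.replicate n i, List.length_replicate, ?_⟩
  obtain ⟨x', -, hx'⟩ := h1 n
  exact ⟨x', p i, hx', h2 n⟩

/-- The function grows along the diagonal from 0 at `p i` to 1 at the opposite corner and is
constant on the two side cells. -/
theorem exists_admissible_ne_vertex (h : IsVicsekSystem ψ p) (hα : IsPolyratio α) {i : Fin 5}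
    (hi : i ≠ 4) (hsum : 1 ≤ α i + α (oppositeVertex i) + α 4) {x : X} (hx : x ≠ p i) :
    ∃ u ∈ admissibleFunctions ψ α, u x ≠ u (p i) := by
  obtain ⟨j, hj⟩ : ∃ j, j = oppositeVertex i := ⟨_, rfl⟩
  have hj4 : j ≠ 4 := hj ▸ oppositeVertex_ne_four hi
  have hji : j ≠ i := hj ▸ oppositeVertex_ne_self hi
  have hjj : oppositeVertex j = i := hj ▸ oppositeVertex_oppositeVertex i
  rw [← hj] at hsum
  have hi0 := (hα i).1
  have hj0 := (hα j).1
  have h40 := (hα 4).1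
  have h41 := (hα 4).2
  -- Shrink the two corner ratios so that the three increments add up to exactly 1; `hsum` is what
  -- makes `r ≤ 1`.
  obtain ⟨r, hr0, hr1, hr⟩ : ∃ r : ℝ, 0 < r ∧ r ≤ 1 ∧ r * α i + r * α j + α 4 = 1 := by
    refine ⟨(1 - α 4) / (α i + α j), by apply div_pos <;> linarith,
      (div_le_one (by linarith)).2 (by linarith), ?_⟩
    field_simp
    ring
  -- The constant on the side cells has to be the fixed value of the central rule `t ↦ r * α i + α 4
  -- * t`.
  obtain ⟨a, ha⟩ : ∃ a : ℝ, a = r * α i + α 4 * a :=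
    ⟨r * α i / (1 - α 4), by
      have : 1 - α 4 ≠ 0 := by linarith
      field_simp
      ring⟩
  have hri : 0 < r * α i := mul_pos hr0 hi0
  have hrj : 0 < r * α j := mul_pos hr0 hj0
  have hri' : r * α i ≤ α i := mul_le_of_le_one_left hi0.le hr1
  have hrj' : r * α j ≤ α j := mul_le_of_le_one_left hj0.le hr1
  have ha0 : 0 ≤ a := by nlinarith
  have ha1 : a ≤ 1 := by nlinarith
  let k : Fin 5 → ℝ := fun m => if m = i then r * α i else if m = j then r * α j else
    if m = 4 then α 4 else 0
  let c : Fin 5 → ℝ := fun m => if m = i then 0 else if m = j then r * α i + α 4 else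
    if m = 4 then r * α i else a
  let b : Fin 5 → ℝ := fun m => if m = i then 0 else if m = j then 1 else a
  have hk0 : ∀ m, 0 ≤ k m := by
    intro m; dsimp only [k]; split_ifs <;> linarith
  have hkα : ∀ m, k m ≤ α m := by
    intro m; dsimp only [k]
    split_ifs with h1 h2 h3
    · rwa [h1]
    · rwa [h2]
    · rw [h3]
    · exact (hα m).1.le
  obtain ⟨u, hu1, hub, hu⟩ := h.exists_selfSimilar c k
    (by intro m; dsimp only [c]; split_ifs <;> linarith) hk0
    (by intro m; dsimp only [c, k]; split_ifs <;> linarith) b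
    (by
      intro m hm; dsimp only [c, k, b]
      split_ifs <;> linarith)
    (fun m => (hkα m).trans_lt (hα m).2)
    (by
      intro m hm
      by_cases hmi : m = i
      · subst hmi
        simp [c, k, b, ← hj, hji, hi.symm, hj4.symm]
      by_cases hmj : m = j
      · subst hmj
        simp [c, k, b, hjj, hji, hi.symm, hj4.symm]
      simp [c, k, b, hmi, hmj, hm, hi.symm, hj4.symm, ← ha])
  have huF : u ∈ admissibleFunctions ψ α :=
    mem_admissibleFunctions_of_selfSimilar
      (fun x y => abs_sub_le_iff.2 ⟨by linarith [(hu1 x).2, (hu1 y).1],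
        by linarith [(hu1 x).1, (hu1 y).2]⟩)
      (fun m => (abs_of_nonneg (hk0 m)).trans_le (hkα m)) hu
  refine ⟨u, huF, fun hux => hx ?_⟩
  -- Outside cell `i` the offset `c m` is positive, so zeros of `u` lie in cell `i` and their
  -- preimages are again zeros.
  refine h.eq_vertex_of_mem_cells (S := {x | u x = 0}) ?_
    (hux.trans (by rw [hub i hi]; simp [b]))
  intro y (hy : u y = 0)
  obtain ⟨m, z, rfl⟩ := h.exists_eq y
  rw [hu] at hy
  have hkz := mul_nonneg (hk0 m) (hu1 z).1
  by_cases hmi : m = i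
  · subst hmi
    refine ⟨z, ?_, rfl⟩
    simp only [c, k, if_true, zero_add] at hy
    exact (mul_eq_zero.1 hy).resolve_left hri.ne'
  · exfalso
    have : 0 < c m := by
      simp only [c, hmi, if_false]
      split_ifs <;> nlinarith
    linarith

/-- Plant `α i * u` in cell `i` and make every other cell constant, with the value at the junction
through which it is reached from cell `i`. -/
theorem exists_admissible_extension (h : IsVicsekSystem ψ p) (hα : IsPolyratio α) (i : Fin 5)
    {u : X → ℝ} (hu : u ∈ admissibleFunctions ψ α) :
    ∃ v ∈ admissibleFunctions ψ α, (∀ x, v (ψ i x) = α i * u x) ∧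
      (i ≠ 4 → ∀ j ≠ i, ∀ x, v (ψ j x) = α i * u (p (oppositeVertex i))) := by
  let q : Fin 5 → X := fun j => if i = 4 then p j else p (oppositeVertex i)
  obtain ⟨v, hv⟩ := h.exists_glue (fun j x => α i * if j = i then u x else u (q j)) (by
    intro m hm
    by_cases hi : i = 4
    · simp [q, hi, hm]
    · by_cases hmi : m = i
      · simp [q, hi, hmi, Ne.symm hi]
      · simp [q, hi, hmi, Ne.symm hi])
  refine ⟨v, mem_admissibleFunctions_of_comp ?_ fun j => ?_, fun x => by simp [hv], ?_⟩
  · have hex : ∀ x, ∃ y, v x = α i * u y := by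
      intro x
      obtain ⟨j, y, rfl⟩ := h.exists_eq x
      by_cases hj : j = i
      · exact ⟨y, by simp [hv, hj]⟩
      · exact ⟨q j, by simp [hv, hj]⟩
    intro x y
    obtain ⟨x', hx⟩ := hex x
    obtain ⟨y', hy⟩ := hex y
    rw [hx, hy, ← mul_sub, abs_mul, abs_of_pos (hα i).1]
    exact mul_le_one₀ (hα i).2.le (abs_nonneg _)
      (abs_sub_le_one_of_mem_admissibleFunctions hu _ _)
  · by_cases hj : j = i
    · subst hj
      exact ⟨u, hu, 0, α j, (abs_of_pos (hα j).1).le, fun x => by simp [hv]⟩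
    · exact ⟨u, hu, α i * u (q j), 0, by simpa using (hα j).1.le, fun x => by simp [hv, hj]⟩
  · intro hi j hj x
    simp [hv, hj, q, hi]

theorem exists_admissible_ne_apply (h : IsVicsekSystem ψ p) (hα : IsPolyratio α) (i : Fin 5)
    {x y : X} (hxy : ∃ u ∈ admissibleFunctions ψ α, u x ≠ u y) :
    ∃ u ∈ admissibleFunctions ψ α, u (ψ i x) ≠ u (ψ i y) := by
  obtain ⟨u, hu, hne⟩ := hxy
  obtain ⟨v, hv, hvi, -⟩ := h.exists_admissible_extension hα i hu
  exact ⟨v, hv, by simpa [hvi, (hα i).1.ne'] using hne⟩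

/-- All the other cells collapse to the value at the junction of cell `i`, which `u` distinguishes
from the value at `x`. -/
theorem exists_admissible_ne_of_corner (h : IsVicsekSystem ψ p) (hα : IsPolyratio α)
    (hsum : ∀ i, i ≠ 4 → 1 ≤ α i + α (oppositeVertex i) + α 4) {i j : Fin 5} (hi : i ≠ 4)
    (hij : j ≠ i) {x y : X} (hx : x ≠ p (oppositeVertex i)) :
    ∃ u ∈ admissibleFunctions ψ α, u (ψ i x) ≠ u (ψ j y) := by
  have hi' := oppositeVertex_ne_four hi
  obtain ⟨u, hu, hne⟩ := h.exists_admissible_ne_vertex hα hi' (hsum _ hi') hx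
  obtain ⟨v, hv, hvi, hvj⟩ := h.exists_admissible_extension hα i hu
  exact ⟨v, hv, by simpa [hvi, hvj hi j hij, (hα i).1.ne'] using hne⟩

theorem exists_admissible_ne (h : IsVicsekSystem ψ p) (hα : IsPolyratio α)
    (hsum : ∀ i, i ≠ 4 → 1 ≤ α i + α (oppositeVertex i) + α 4) {x y : X} (hxy : x ≠ y) :
    ∃ u ∈ admissibleFunctions ψ α, u x ≠ u y := by
  by_contra hcon
  refine hxy (h.eq_of_common_cells x y fun n => ?_)
  suffices H : ∃ w : List (Fin 5), w.length = n ∧ ∃ x' y', x = w.foldr ψ x' ∧ y = w.foldr ψ y' ∧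
      ¬ ∃ u ∈ admissibleFunctions ψ α, u x' ≠ u y' by
    obtain ⟨w, hw, x', y', hx, hy, -⟩ := H
    exact ⟨w, hw, x', y', hx, hy⟩
  have step : ∀ x y : X, (¬ ∃ u ∈ admissibleFunctions ψ α, u x ≠ u y) →
      ∃ i x' y', x = ψ i x' ∧ y = ψ i y' := by
    intro x y hxy
    obtain ⟨i, a, rfl⟩ := h.exists_eq x
    obtain ⟨j, b, rfl⟩ := h.exists_eq y
    by_cases hij : j = i
    · exact ⟨i, a, b, rfl, by rw [hij]⟩
    have ha : i = 4 ∨ a = p (oppositeVertex i) := by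
      by_contra! hc
      exact hxy (h.exists_admissible_ne_of_corner hα hsum hc.1 hij hc.2)
    have hb : j = 4 ∨ b = p (oppositeVertex j) := by
      by_contra! hc
      obtain ⟨u, hu, hne⟩ := h.exists_admissible_ne_of_corner hα hsum hc.1 (Ne.symm hij)
        (y := a) hc.2
      exact hxy ⟨u, hu, hne.symm⟩
    -- A junction also belongs to the central cell, so both points can be placed there.
    have key : ∀ i a, (i = 4 ∨ a = p (oppositeVertex i)) → ∃ a', ψ i a = ψ 4 a' := by
      rintro i a (rfl | rfl)
      · exact ⟨a, rfl⟩
      · exact ⟨_, h.apply_opposite i⟩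
    obtain ⟨a', ha'⟩ := key i a ha
    obtain ⟨b', hb'⟩ := key j b hb
    exact ⟨4, a', b', ha', hb'⟩
  induction n with
  | zero => exact ⟨[], rfl, x, y, rfl, rfl, hcon⟩
  | succ n ih =>
    obtain ⟨w, hw, x', y', hx, hy, hne⟩ := ih
    obtain ⟨i, a, b, rfl, rfl⟩ := step x' y' hne
    -- `foldr` applies the last letter first, so appending `i` refines the cell.
    exact ⟨w ++ [i], by simp [hw], a, b, by simp [hx], by simp [hy],
      fun hab => hne (h.exists_admissible_ne_apply hα i hab)⟩

theorem one_le_sum_of_isMetricPolyratio (h : IsVicsekSystem ψ p) (hm : IsMetricPolyratio ψ α)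
    {i : Fin 5} (hi : i ≠ 4) : 1 ≤ α i + α (oppositeVertex i) + α 4 := by
  obtain ⟨m, hm⟩ := hm
  obtain ⟨j, hj⟩ : ∃ j, j = oppositeVertex i := ⟨_, rfl⟩
  have hji : j ≠ i := hj ▸ oppositeVertex_ne_self hi
  have hjj : oppositeVertex j = i := hj ▸ oppositeVertex_oppositeVertex i
  have hpos : 0 < dist (p i) (p j) := dist_pos.2 fun he => hji (h.vertex_injective he).symm
  have h1 := hm i (p i) (p j)
  have h2 := hm 4 (p i) (p j)
  have h3 := hm j (p i) (p j)
  have hci := h.apply_opposite i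
  have hcj := h.apply_opposite j
  rw [← hj] at hci ⊢
  rw [hjj] at hcj
  rw [h.apply_self, hci] at h1
  rw [h.apply_self, hcj] at h3
  have h4 := dist_triangle4 (p i) (ψ 4 (p i)) (ψ 4 (p j)) (p j)
  by_contra! hlt
  nlinarith

end IsVicsekSystem

/-! ### Coordinates on the square and geometry of the cells -/

/-- The first coordinates of the vertices and the center of the standard square. -/
def squareFst : Fin 5 → ℝ := ![1, 0, -1, 0, 0]

/-- The second coordinates of the vertices and the center of the standard square. -/
def squareSnd : Fin 5 → ℝ := ![0, 1, 0, -1, 0]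

theorem squareFst_oppositeVertex (i : Fin 5) : squareFst (oppositeVertex i) = -squareFst i := by
  fin_cases i <;> simp [squareFst, oppositeVertex]

theorem squareSnd_oppositeVertex (i : Fin 5) : squareSnd (oppositeVertex i) = -squareSnd i := by
  fin_cases i <;> simp [squareSnd, oppositeVertex]

/-- A point of the set nearest to `P i` is moved by the contraction to a third of its distance, so
that distance is 0. -/
theorem vertex_mem_vicsekSet (P : Fin 5 → EuclideanSpace ℝ (Fin 2)) (i : Fin 5) :
    P i ∈ vicsekSet P := by
  obtain ⟨x, hx, hmin⟩ := (isSelfSimilarSet_vicsekSet P).isCompact.exists_isMinOn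
    (isSelfSimilarSet_vicsekSet P).nonempty (f := fun x => ‖x - P i‖) (by fun_prop)
  have h1 : ‖x - P i‖ ≤ ‖vicsekContraction P i x - P i‖ := hmin (mapsTo_vicsekSet P i hx)
  have h2 : vicsekContraction P i x - P i = (1 / 3 : ℝ) • (x - P i) := by
    rw [vicsekContraction_apply]
    module
  rw [h2, norm_smul] at h1
  norm_num at h1
  have h3 : ‖x - P i‖ = 0 := by linarith [norm_nonneg (x - P i)]
  rw [norm_eq_zero, sub_eq_zero] at h3
  rwa [← h3]

theorem eq_zero_of_inner_eq_zero {e f v : EuclideanSpace ℝ (Fin 2)} (he : e ≠ 0) (hf : f ≠ 0)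
    (hef : inner ℝ e f = 0) (hve : inner ℝ v e = 0) (hvf : inner ℝ v f = 0) : v = 0 := by
  have he' : 0 < inner ℝ e e := real_inner_self_pos.2 he
  have hf' : 0 < inner ℝ f f := real_inner_self_pos.2 hf
  simp only [PiLp.inner_apply, Fin.sum_univ_two, RCLike.inner_apply, conj_trivial] at *
  have hpos := mul_pos he' hf'
  -- Lagrange's identity with `inner ℝ e f = 0`; the nonzero determinant then allows Cramer's rule.
  have hdet : (e 0 * f 1 - e 1 * f 0) ^ 2 =
      (e 0 * e 0 + e 1 * e 1) * (f 0 * f 0 + f 1 * f 1) := by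
    linear_combination (-(f 0 * e 0 + f 1 * e 1)) * hef
  have hdet' : e 0 * f 1 - e 1 * f 0 ≠ 0 := by
    intro h0
    rw [h0] at hdet
    linarith
  have h0 : v 0 * (e 0 * f 1 - e 1 * f 0) = 0 := by linear_combination f 1 * hve - e 1 * hvf
  have h1 : v 1 * (e 0 * f 1 - e 1 * f 0) = 0 := by linear_combination e 0 * hvf - f 0 * hve
  ext i
  fin_cases i
  · exact (mul_eq_zero.1 h0).resolve_right hdet'
  · exact (mul_eq_zero.1 h1).resolve_right hdet'

theorem IsCenteredSquare.exists_coordinates {P : Fin 5 → EuclideanSpace ℝ (Fin 2)}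
    (hP : IsCenteredSquare P) :
    ∃ s t : EuclideanSpace ℝ (Fin 2) → ℝ, Continuous s ∧ Continuous t ∧
      (∀ x y, s x = s y → t x = t y → x = y) ∧
      (∀ i, s (P i) = squareFst i) ∧ (∀ i, t (P i) = squareSnd i) ∧
      (∀ i x, s (vicsekContraction P i x) = (s x + 2 * squareFst i) / 3) ∧
      (∀ i x, t (vicsekContraction P i x) = (t x + 2 * squareSnd i) / 3) := by
  obtain ⟨e, he⟩ : ∃ e, e = P 0 - P 4 := ⟨_, rfl⟩
  obtain ⟨f, hf⟩ : ∃ f, f = P 1 - P 4 := ⟨_, rfl⟩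
  have h02 := hP.midpoint_zero_two
  have h13 := hP.midpoint_one_three
  rw [midpoint_eq_smul_add] at h02 h13
  have he2 : P 2 - P 4 = -e := by
    rw [he, ← h02]
    norm_num
    module
  have hf2 : P 3 - P 4 = -f := by
    rw [hf, ← h13]
    norm_num
    module
  have hee : P 2 - P 0 = (-2 : ℝ) • e := by
    rw [show P 2 - P 0 = (P 2 - P 4) - (P 0 - P 4) by abel, he2, ← he]
    module
  have hff : P 3 - P 1 = (-2 : ℝ) • f := by
    rw [show P 3 - P 1 = (P 3 - P 4) - (P 1 - P 4) by abel, hf2, ← hf]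
    module
  have he0 : e ≠ 0 := by
    rintro rfl
    exact hP.ne (by simpa [sub_eq_zero, eq_comm] using hee)
  have hf0 : f ≠ 0 := by
    rintro rfl
    have h1 : P 3 = P 1 := by simpa [sub_eq_zero] using hff
    have h2 := hP.dist_eq
    rw [h1, dist_self, dist_eq_zero] at h2
    exact hP.ne h2
  have hef : inner ℝ e f = 0 := by
    have := hP.inner_eq_zero
    rw [hee, hff, real_inner_smul_left, real_inner_smul_right] at this
    linarith
  have hfe : inner ℝ f e = 0 := by rwa [real_inner_comm]
  have hne : inner ℝ e e ≠ 0 := (real_inner_self_pos.2 he0).ne'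
  have hnf : inner ℝ f f ≠ 0 := (real_inner_self_pos.2 hf0).ne'
  have hs : ∀ i, inner ℝ (P i - P 4) e / inner ℝ e e = squareFst i := by
    intro i
    fin_cases i
    · change inner ℝ (P 0 - P 4) e / inner ℝ e e = 1
      rw [← he, div_self hne]
    · change inner ℝ (P 1 - P 4) e / inner ℝ e e = 0
      rw [← hf, hfe, zero_div]
    · change inner ℝ (P 2 - P 4) e / inner ℝ e e = -1
      rw [he2, inner_neg_left, neg_div, div_self hne]
    · change inner ℝ (P 3 - P 4) e / inner ℝ e e = 0
      rw [hf2, inner_neg_left, hfe, neg_zero, zero_div]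
    · change inner ℝ (P 4 - P 4) e / inner ℝ e e = 0
      rw [sub_self, inner_zero_left, zero_div]
  have ht : ∀ i, inner ℝ (P i - P 4) f / inner ℝ f f = squareSnd i := by
    intro i
    fin_cases i
    · change inner ℝ (P 0 - P 4) f / inner ℝ f f = 0
      rw [← he, hef, zero_div]
    · change inner ℝ (P 1 - P 4) f / inner ℝ f f = 1
      rw [← hf, div_self hnf]
    · change inner ℝ (P 2 - P 4) f / inner ℝ f f = 0
      rw [he2, inner_neg_left, hef, neg_zero, zero_div]
    · change inner ℝ (P 3 - P 4) f / inner ℝ f f = -1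
      rw [hf2, inner_neg_left, neg_div, div_self hnf]
    · change inner ℝ (P 4 - P 4) f / inner ℝ f f = 0
      rw [sub_self, inner_zero_left, zero_div]
  have hψ : ∀ i x, vicsekContraction P i x - P 4 =
      (1 / 3 : ℝ) • (x - P 4) + (2 / 3 : ℝ) • (P i - P 4) := by
    intro i x
    rw [vicsekContraction_apply]
    module
  refine ⟨fun x => inner ℝ (x - P 4) e / inner ℝ e e, fun x => inner ℝ (x - P 4) f / inner ℝ f f,
    by fun_prop, by fun_prop, ?_, hs, ht, ?_, ?_⟩
  · intro x y h1 h2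
    rw [div_left_inj' hne, ← sub_eq_zero, ← inner_sub_left, sub_sub_sub_cancel_right] at h1
    rw [div_left_inj' hnf, ← sub_eq_zero, ← inner_sub_left, sub_sub_sub_cancel_right] at h2
    exact sub_eq_zero.1 (eq_zero_of_inner_eq_zero he0 hf0 hef h1 h2)
  · intro i x
    rw [← hs i]
    simp only [hψ, inner_add_left, real_inner_smul_left]
    ring
  · intro i x
    rw [← ht i]
    simp only [hψ, inner_add_left, real_inner_smul_left]
    ring

theorem abs_squareFst_add_abs_squareSnd_le (i : Fin 5) :
    |squareFst i| + |squareSnd i| ≤ 1 := by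
  fin_cases i <;> simp [squareFst, squareSnd]

/-- The maximum `M` of `|s| + |t|` on the set is attained in some cell, so `M ≤ (M + 2) / 3`. -/
theorem IsCenteredSquare.abs_add_abs_le {P : Fin 5 → EuclideanSpace ℝ (Fin 2)}
    {s t : EuclideanSpace ℝ (Fin 2) → ℝ} (hsc : Continuous s) (htc : Continuous t)
    (hs : ∀ i x, s (vicsekContraction P i x) = (s x + 2 * squareFst i) / 3)
    (ht : ∀ i x, t (vicsekContraction P i x) = (t x + 2 * squareSnd i) / 3)
    {x : EuclideanSpace ℝ (Fin 2)} (hx : x ∈ vicsekSet P) : |s x| + |t x| ≤ 1 := by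
  have hK := isSelfSimilarSet_vicsekSet P
  obtain ⟨z, hz, hmax⟩ := hK.isCompact.exists_isMaxOn hK.nonempty
    (f := fun x => |s x| + |t x|) (by fun_prop)
  have hz' := hz
  rw [hK.eq_iUnion] at hz'
  obtain ⟨i, y, hy, rfl⟩ : ∃ i, ∃ y ∈ vicsekSet P, vicsekContraction P i y = z := by
    simpa using hz'
  have h1 : |s x| + |t x| ≤ |s (vicsekContraction P i y)| + |t (vicsekContraction P i y)| :=
    hmax hx
  have h2 : |s y| + |t y| ≤ |s (vicsekContraction P i y)| + |t (vicsekContraction P i y)| :=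
    hmax hy
  rw [hs, ht, abs_div, abs_div, abs_of_pos (three_pos (α := ℝ))] at h1 h2
  have h3 := abs_add_le (s y) (2 * squareFst i)
  have h4 := abs_add_le (t y) (2 * squareSnd i)
  rw [abs_mul, abs_two] at h3 h4
  linarith [abs_squareFst_add_abs_squareSnd_le i]

/-- After scaling by 3 the cells lie in unit `ℓ¹` balls: the corner balls are disjoint, and each
touches the central one tip to tip. -/
theorem square_cells_inter {a b c d : ℝ} (h1 : |a| + |b| ≤ 1) (h2 : |c| + |d| ≤ 1)
    {i j : Fin 5} (hij : i ≠ j) (hs : a + 2 * squareFst i = c + 2 * squareFst j)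
    (ht : b + 2 * squareSnd i = d + 2 * squareSnd j) :
    (j = 4 ∧ (a = squareFst (oppositeVertex i) ∧ b = squareSnd (oppositeVertex i)) ∧
        c = squareFst i ∧ d = squareSnd i) ∨
      (i = 4 ∧ (c = squareFst (oppositeVertex j) ∧ d = squareSnd (oppositeVertex j)) ∧
        a = squareFst j ∧ b = squareSnd j) := by
  have ha := le_abs_self a
  have ha' := neg_abs_le a
  have hb := le_abs_self b
  have hb' := neg_abs_le b
  have hc := le_abs_self c
  have hc' := neg_abs_le c
  have hd := le_abs_self d
  have hd' := neg_abs_le d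
  fin_cases i <;> fin_cases j <;>
    first
    | exact absurd rfl hij
    | (simp [squareFst, squareSnd, oppositeVertex] at hs ht ⊢
       first
       | linarith
       | (refine ⟨⟨?_, ?_⟩, ?_, ?_⟩ <;> linarith))

theorem IsCenteredSquare.isVicsekSystem {P : Fin 5 → EuclideanSpace ℝ (Fin 2)}
    (hP : IsCenteredSquare P) :
    IsVicsekSystem (vicsekMap P) fun i => ⟨P i, vertex_mem_vicsekSet P i⟩ := by
  obtain ⟨s, t, hsc, htc, hst, hsP, htP, hs, ht⟩ := hP.exists_coordinates
  have hb : ∀ x : vicsekSet P, |s x| + |t x| ≤ 1 := fun x =>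
    IsCenteredSquare.abs_add_abs_le hsc htc hs ht x.2
  have hs' : ∀ i (x : vicsekSet P), s (vicsekMap P i x) = (s x + 2 * squareFst i) / 3 :=
    fun i x => hs i x
  have ht' : ∀ i (x : vicsekSet P), t (vicsekMap P i x) = (t x + 2 * squareSnd i) / 3 :=
    fun i x => ht i x
  have hext : ∀ x y : vicsekSet P, s x = s y → t x = t y → x = y :=
    fun x y h1 h2 => Subtype.ext (hst _ _ h1 h2)
  refine ⟨?_, ?_, ?_, ?_, ?_, ?_, ?_⟩
  · rintro ⟨x, hx⟩
    have hx' := hx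
    rw [(isSelfSimilarSet_vicsekSet P).eq_iUnion] at hx'
    obtain ⟨i, y, hy, rfl⟩ : ∃ i, ∃ y ∈ vicsekSet P, vicsekContraction P i y = x := by
      simpa using hx'
    exact ⟨i, ⟨y, hy⟩, rfl⟩
  · intro i x y hxy
    have h1 := congrArg (fun z : vicsekSet P => s z) hxy
    have h2 := congrArg (fun z : vicsekSet P => t z) hxy
    simp only [hs', ht'] at h1 h2
    exact hext _ _ (by linarith) (by linarith)
  · intro i j x y hij hxy
    have h1 := congrArg (fun z : vicsekSet P => s z) hxy
    have h2 := congrArg (fun z : vicsekSet P => t z) hxy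
    simp only [hs', ht'] at h1 h2
    rcases square_cells_inter (hb x) (hb y) hij (by linarith) (by linarith) with
      ⟨h4, ⟨ha, hb⟩, hc, hd⟩ | ⟨h4, ⟨ha, hb⟩, hc, hd⟩
    · exact Or.inl ⟨h4, hext _ _ (by simp [ha, hsP]) (by simp [hb, htP]),
        hext _ _ (by simp [hc, hsP]) (by simp [hd, htP])⟩
    · exact Or.inr ⟨h4, hext _ _ (by simp [ha, hsP]) (by simp [hb, htP]),
        hext _ _ (by simp [hc, hsP]) (by simp [hd, htP])⟩
  · intro i
    refine hext _ _ ?_ ?_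
    · simp only [hs', hsP]
      rw [squareFst_oppositeVertex, show squareFst 4 = 0 from rfl]
      ring
    · simp only [ht', htP]
      rw [squareSnd_oppositeVertex, show squareSnd 4 = 0 from rfl]
      ring
  · intro i
    refine hext _ _ ?_ ?_
    · simp only [hs', hsP]
      ring
    · simp only [ht', htP]
      ring
  · intro i j hij
    have hij' : P i = P j := congrArg Subtype.val hij
    have h1 : squareFst i = squareFst j := by rw [← hsP, ← hsP, hij']
    have h2 : squareSnd i = squareSnd j := by rw [← htP, ← htP, hij']
    fin_cases i <;> fin_cases j <;> first
      | rfl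
      | (norm_num [squareFst] at h1; done)
      | (norm_num [squareSnd] at h2)
  · intro x y hxy
    -- Coordinate differences within a common cell of level `n` are at most `2 / 3 ^ n`.
    have hfold : ∀ (r : vicsekSet P → ℝ) (σ : Fin 5 → ℝ),
        (∀ i x, r (vicsekMap P i x) = (r x + 2 * σ i) / 3) → (∀ x, |r x| ≤ 1) → r x = r y := by
      intro r σ hr hr1
      have h1 : ∀ (w : List (Fin 5)) x y, r (w.foldr (vicsekMap P) x) -
          r (w.foldr (vicsekMap P) y) = (1 / 3) ^ w.length * (r x - r y) := by
        intro w x y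
        induction w with
        | nil => simp
        | cons i w ih =>
          simp only [List.foldr_cons, List.length_cons, hr, pow_succ]
          linear_combination (1 / 3) * ih
      have h2 : ∀ n : ℕ, |r x - r y| ≤ (1 / 3) ^ n * 2 := by
        intro n
        obtain ⟨w, rfl, x', y', rfl, rfl⟩ := hxy n
        rw [h1, abs_mul, abs_of_pos (by positivity)]
        gcongr
        linarith [abs_sub (r x') (r y'), hr1 x', hr1 y']
      have h3 : Filter.Tendsto (fun n : ℕ => (1 / 3 : ℝ) ^ n * 2) Filter.atTop (nhds (0 * 2)) :=
        (tendsto_pow_atTop_nhds_zero_of_lt_one (by norm_num) (by norm_num)).mul_const 2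
      have h4 := ge_of_tendsto' h3 h2
      rw [zero_mul] at h4
      exact sub_eq_zero.1 (abs_nonpos_iff.1 h4)
    exact hext _ _
      (hfold (fun x => s x) _ hs' fun x => by linarith [hb x, abs_nonneg (t x)])
      (hfold (fun x => t x) _ ht' fun x => by linarith [hb x, abs_nonneg (s x)])

theorem mainTheorem5 (P : Fin 5 → EuclideanSpace ℝ (Fin 2)) (hP : IsCenteredSquare P)
    (α : Fin 5 → ℝ) (hα : IsPolyratio α) :
    IsMetricPolyratio (vicsekMap P) α ↔
      1 ≤ α 0 + α 2 + α 4 ∧ 1 ≤ α 1 + α 3 + α 4 := by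
  have h := hP.isVicsekSystem
  constructor
  · intro hm
    exact ⟨h.one_le_sum_of_isMetricPolyratio hm (i := 0) (by decide),
      h.one_le_sum_of_isMetricPolyratio hm (i := 1) (by decide)⟩
  · rintro ⟨h02, h13⟩
    refine isMetricPolyratio_of_separating (fun i => (hα i).1) fun x y hxy =>
      h.exists_admissible_ne hα (fun i hi => ?_) hxy
    fin_cases i
    · exact h02
    · exact h13
    · change 1 ≤ α 2 + α 0 + α 4
      linarith
    · change 1 ≤ α 3 + α 1 + α 4
      linarith
    · exact absurd rfl hi
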